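/- Let $\mathbb K$ be an algebraically closed field, let $V$ be a nonzero finite-dimensional vector space over $\mathbb K$, and let $A,A^*:V\to V$ be a tridiagonal pair of diameter $d\ge 1$. That is: $A$ and $A^*$ are diagonalizable linear maps; there are orderings $V_0,\dots,V_d$ of the eigenspaces of $A$ and $V_0^*,\dots,V_d^*$ of the eigenspaces of $A^*$ such that $A^*V_i\subseteq V_{i-1}+V_i+V_{i+1}$ and $AV_i^*\subseteq V_{i-1}^*+V_i^*+V_{i+1}^*$ for $0\le i\le d$ (with $V_{-1}=V_{d+1}=V^*_{-1}=V^*_{d+1}=0$); and no subspace $W\ne 0,V$ satisfies both $AW\subseteq W$ and $A^*W\subseteq W$. Fix such orderings, and let $\theta_i$ (resp. $\theta_i^*$) be the eigenvalue of $A$ on $V_i$ (resp. of $A^*$ on $V_i^*$). Assume the $q$-Racah type: there are nonzero $q,a,b\in\mathbb K$ with $q^4\ne 1$ and $$\theta_i=aq^{d-2i}+a^{-1}q^{2i-d},\qquad \theta_i^*=bq^{d-2i}+b^{-1}q^{2i-d}\qquad(0\le i\le d).$$ For $0\le i\le d$ put $$U_i=(V_0^*+\cdots+V_i^*)\cap(V_i+\cdots+V_d),\qquad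 U_i^{\Downarrow}=(V_0^*+\cdots+V_i^*)\cap(V_0+\cdots+V_{d-i}),$$ and for $0\le i\le d/2$ put $K_i=(V_0^*+\cdots+V_i^*)\cap(V_i+\cdots+V_{d-i})$. Then the following maps are well defined. There is a unique linear map $K:V\to V$ that acts on $U_i$ as $q^{d-2i}$ for $0\le i\le d$, and a unique linear map $B:V\to V$ that acts on $U_i^{\Downarrow}$ as $q^{d-2i}$ for $0\le i\le d$; both are invertible. Put $$R=A-aK-a^{-1}K^{-1},\qquad R^{\Downarrow}=A-a^{-1}B-aB^{-1}.$$ There is a unique linear map $\psi:V\to V$ such that $\psi R-R\psi=(q-q^{-1})(K-K^{-1})$ and $\psi K_i=0$ for $0\le i\le d/2$. Moreover, the following equations hold: $$B=a^{2}K+(1-a^{2})K\sum_{i=0}^d a^{-i}q^{-i}\psi^i,$$ $$B^{-1}=a^{-2}K^{-1}+(1-a^{-2})K^{-1}\sum_{i=0}^d a^{i}q^{i}\psi^i,$$ $$R^{\Downarrow}=R+(a-a^{-1})\sum_{i=0}^d\left(a^{-i}q^{-i}K-a^{i}q^{i}K^{-1}\right)\psi^i,$$ and conversely $$K=a^{-2}B+(1-a^{-2})B\sum_{i=0}^d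 a^{i}q^{-i}\psi^i,$$ $$K^{-1}=a^{2}B^{-1}+(1-a^{2})B^{-1}\sum_{i=0}^d a^{-i}q^{i}\psi^i,$$ $$R=R^{\Downarrow}+(a-a^{-1})\sum_{i=0}^d\left(a^{-i}q^{i}B^{-1}-a^{i}q^{-i}B\right)\psi^i.$$ -/

import Mathlib

/-!
Tridiagonal systems: a tridiagonal pair `A, A*` together with standard orderings of the eigenspaces
of `A` and of `A*`. An ordering of the eigenspaces (equivalently of the primitive idempotents) is
recorded by the corresponding ordering of the eigenvalues.
-/

namespace TD

variable {𝕂 V : Type*} [Field 𝕂] [AddCommGroup V] [Module 𝕂 V] {d : ℕ}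

/-- `A` is diagonalizable (`V` is spanned by the eigenspaces of `A`), and `θ 0, …, θ d` is an
ordering of the eigenvalues of `A`, each listed exactly once. The `i`-th eigenspace in the
corresponding ordering of the eigenspaces is `A.eigenspace (θ i)`. -/
structure IsEigenOrdering (A : Module.End 𝕂 V) (θ : Fin (d + 1) → 𝕂) : Prop where
  diagonalizable : ⨆ μ : 𝕂, A.eigenspace μ = ⊤
  injective : Function.Injective θ
  hasEigenvalue_iff : ∀ μ : 𝕂, A.HasEigenvalue μ ↔ ∃ i, θ i = μ

/-- The ordering `θ` of the eigenvalues of `A` is standard with respect to `X`: writing `V i` for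
the eigenspace of `A` with eigenvalue `θ i`, one has `X (V i) ⊆ V (i-1) + V i + V (i+1)` for
`0 ≤ i ≤ d`, where `V (-1) = V (d+1) = 0`. -/
def IsStandard (A X : Module.End 𝕂 V) (θ : Fin (d + 1) → 𝕂) : Prop :=
  ∀ i : Fin (d + 1), (A.eigenspace (θ i)).map X ≤
    ⨆ j : Fin (d + 1), ⨆ _ : (j : ℕ) ≤ (i : ℕ) + 1 ∧ (i : ℕ) ≤ (j : ℕ) + 1, A.eigenspace (θ j)

/-- `A, As` is a tridiagonal pair on `V`, `θ` is a standard ordering of the eigenvalues of `A`, and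
`θs` is a standard ordering of the eigenvalues of `As`. -/
structure IsTDSystem (A As : Module.End 𝕂 V) (θ θs : Fin (d + 1) → 𝕂) : Prop where
  ordering : IsEigenOrdering A θ
  ordering_dual : IsEigenOrdering As θs
  standard : IsStandard A As θ
  standard_dual : IsStandard As A θs
  irreducible : ∀ W : Submodule 𝕂 V, W.map A ≤ W → W.map As ≤ W → W = ⊥ ∨ W = ⊤

/-- The sum `V m + V (m+1) + ⋯ + V n` of the eigenspaces of `A`, in the ordering given by `θ`. -/
def eigenSum (A : Module.End 𝕂 V) (θ : Fin (d + 1) → 𝕂) (m n : ℕ) : Submodule 𝕂 V :=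
  ⨆ j : Fin (d + 1), ⨆ _ : m ≤ (j : ℕ) ∧ (j : ℕ) ≤ n, A.eigenspace (θ j)

/-- The component `U i` of the first split decomposition:
`(V*_0 + ⋯ + V*_i) ∩ (V_i + ⋯ + V_d)`. -/
def splitU (A As : Module.End 𝕂 V) (θ θs : Fin (d + 1) → 𝕂) (i : ℕ) : Submodule 𝕂 V :=
  eigenSum As θs 0 i ⊓ eigenSum A θ i d

/-- The component `U i ⇓` of the second split decomposition:
`(V*_0 + ⋯ + V*_i) ∩ (V_0 + ⋯ + V_{d-i})`, for `i ≤ d`. -/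
def splitUDown (A As : Module.End 𝕂 V) (θ θs : Fin (d + 1) → 𝕂) (i : ℕ) : Submodule 𝕂 V :=
  eigenSum As θs 0 i ⊓ eigenSum A θ 0 (d - i)

/-- The subspace `K_i = (V*_0 + ⋯ + V*_i) ∩ (V_i + ⋯ + V_{d-i})`, for `2 i ≤ d`. -/
def kerK (A As : Module.End 𝕂 V) (θ θs : Fin (d + 1) → 𝕂) (i : ℕ) : Submodule 𝕂 V :=
  eigenSum As θs 0 i ⊓ eigenSum A θ i (d - i)

/-- `X` acts on the subspace `U i` as the scalar `q ^ (d - 2 i)`, for `0 ≤ i ≤ d`. -/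
def ActsByWeights (d : ℕ) (q : 𝕂) (U : ℕ → Submodule 𝕂 V) (X : Module.End 𝕂 V) : Prop :=
  ∀ i : ℕ, i ≤ d → ∀ v ∈ U i, X v = q ^ ((d : ℤ) - 2 * (i : ℤ)) • v

/-- The raising map `A - a K - a⁻¹ K⁻¹`. The raising map `R` is `raising A a K` and `R ⇓` is
`raising A a⁻¹ B`. -/
def raising (A : Module.End 𝕂 V) (a : 𝕂) (K : (Module.End 𝕂 V)ˣ) : Module.End 𝕂 V :=
  A - a • (K : Module.End 𝕂 V) - a⁻¹ • ((K⁻¹ : (Module.End 𝕂 V)ˣ) : Module.End 𝕂 V)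

/-- The two conditions that characterize `ψ`: `X R - R X = (q - q⁻¹) (K - K⁻¹)`, and `X` vanishes on
`K_i` for `0 ≤ i ≤ d / 2`. -/
structure IsPsi (A As : Module.End 𝕂 V) (θ θs : Fin (d + 1) → 𝕂) (q a : 𝕂)
    (K : (Module.End 𝕂 V)ˣ) (X : Module.End 𝕂 V) : Prop where
  commutator : X * raising A a K - raising A a K * X =
    (q - q⁻¹) • ((K : Module.End 𝕂 V) - ((K⁻¹ : (Module.End 𝕂 V)ˣ) : Module.End 𝕂 V))
  vanish : ∀ i : ℕ, 2 * i ≤ d → ∀ v ∈ kerK A As θ θs i, X v = 0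

end TD

/-!
Write `F n = V*_0 + ⋯ + V*_{n-1}` and `G n = V_n + ⋯ + V_d`. Irreducibility forces
`F n ∩ G n = 0` and `V = ⨁ U i`; applying this also to the reversed ordering of the eigenspaces
of `A` (which turns `U` into `U⇓` and `a` into `a⁻¹`) gives `dim U i = dim U (d - i)`. A vector of
`U i` killed by `(A - θ (j - 1)) ⋯ (A - θ i)` lies in `F (i + 1)` and in `V_i + ⋯ + V_{j-1}`, hence
vanishes if `i + j ≤ d`. So this product is a bijection `U i → U (d - i)` for `j = d - i`, and it
follows, as for primitive vectors of `sl₂`, that the `K_i` generate `V` under the raising maps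
`A - θ i : U i → U (i + 1)` (`IsTDSystem.eq_top_of_kerK_le`). This gives the uniqueness of `ψ`.

For the existence, `K` and `B` satisfy
`K A = q⁻² A K + (1 - q⁻²) (a K² + a⁻¹)` and `B A = q⁻² A B + (1 - q⁻²) (a⁻¹ B² + a)`.
They preserve the flag `F` and agree on its quotients, so `y = K⁻¹ B` is unipotent, and
`ψ = q (1 - y) / (a - a⁻¹ y)` is defined and nilpotent because `a² ≠ 1` (as `θ 0 ≠ θ d`). It kills
`K_i`, where `K` and `B` are the same scalar. Two facts remain.

* `K ψ = q² ψ K` is equivalent to a homogeneous quadratic relation between `K` and `B`. The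
  quadratic expression vanishes on each `K_i`, and by the two relations with `A` this vanishing
  propagates to the `A`-invariant subspace they generate (`quadraticDefect_mul`), that is, to `V`.
* Given `K ψ = q² ψ K`, the relation between `B` and `A` is equivalent to the commutator relation
  for `ψ` (`commutator_eq`).

All six equations are then geometric series expansions of `K⁻¹ B = (1 - a q⁻¹ ψ) / (1 - a⁻¹ q⁻¹ ψ)`
and of the same identity for the inverses.
-/

namespace TD

variable {𝕂 V : Type*} [Field 𝕂] [AddCommGroup V] [Module 𝕂 V] {d : ℕ}
  {A As : Module.End 𝕂 V} {θ θs : Fin (d + 1) → 𝕂}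

/-! ### Sums of eigenspaces -/

/-- The sum of the eigenspaces of `A` whose position in the ordering `θ` lies in `J`. Positions are
natural numbers, and members of `J` greater than `d` contribute nothing. -/
def specSum (A : Module.End 𝕂 V) (θ : Fin (d + 1) → 𝕂) (J : Set ℕ) : Submodule 𝕂 V :=
  ⨆ j : Fin (d + 1), ⨆ _ : (j : ℕ) ∈ J, A.eigenspace (θ j)

theorem eigenSum_eq_specSum (m n : ℕ) : eigenSum A θ m n = specSum A θ (Set.Icc m n) := rfl

theorem eigenspace_le_specSum {J : Set ℕ} (j : Fin (d + 1)) (hj : (j : ℕ) ∈ J) :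
    A.eigenspace (θ j) ≤ specSum A θ J :=
  le_iSup₂_of_le j hj le_rfl

theorem specSum_le {J : Set ℕ} {W : Submodule 𝕂 V}
    (h : ∀ j : Fin (d + 1), (j : ℕ) ∈ J → A.eigenspace (θ j) ≤ W) : specSum A θ J ≤ W :=
  iSup₂_le h

theorem specSum_mono {J J' : Set ℕ} (h : ∀ j ≤ d, j ∈ J → j ∈ J') :
    specSum A θ J ≤ specSum A θ J' :=
  specSum_le fun j hj => eigenspace_le_specSum j (h j (by omega) hj)

theorem specSum_congr {J J' : Set ℕ} (h : ∀ j ≤ d, j ∈ J ↔ j ∈ J') :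
    specSum A θ J = specSum A θ J' :=
  le_antisymm (specSum_mono fun j hj => (h j hj).1) (specSum_mono fun j hj => (h j hj).2)

theorem specSum_union (J J' : Set ℕ) :
    specSum A θ (J ∪ J') = specSum A θ J ⊔ specSum A θ J' := by
  apply le_antisymm
  · refine specSum_le fun j hj => ?_
    rcases hj with hj | hj
    · exact le_sup_of_le_left (eigenspace_le_specSum j hj)
    · exact le_sup_of_le_right (eigenspace_le_specSum j hj)
  · exact sup_le (specSum_mono fun j _ hj => Or.inl hj) (specSum_mono fun j _ hj => Or.inr hj)

theorem specSum_eq_bot {J : Set ℕ} (h : ∀ j ≤ d, j ∉ J) : specSum A θ J = ⊥ :=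
  eq_bot_iff.2 (specSum_le fun j hj => absurd hj (h j (by omega)))

theorem specSum_eq_top (hA : IsEigenOrdering A θ) {J : Set ℕ} (h : ∀ j ≤ d, j ∈ J) :
    specSum A θ J = ⊤ := by
  rw [eq_top_iff, ← hA.diagonalizable]
  refine iSup_le fun μ => ?_
  by_cases hμ : A.HasEigenvalue μ
  · obtain ⟨i, rfl⟩ := (hA.hasEigenvalue_iff μ).1 hμ
    exact eigenspace_le_specSum i (h i (by omega))
  · have : A.eigenspace μ = ⊥ := by
      simpa [Module.End.hasEigenvalue_iff] using hμ
    rw [this]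
    exact bot_le

theorem disjoint_specSum (hA : IsEigenOrdering A θ) {J J' : Set ℕ} (h : ∀ j ∈ J, j ∉ J') :
    Disjoint (specSum A θ J) (specSum A θ J') := by
  have hind : iSupIndep fun j : Fin (d + 1) => A.eigenspace (θ j) :=
    (Module.End.eigenspaces_iSupIndep A).comp hA.injective
  have hdis : Disjoint ((fun j : Fin (d + 1) => (j : ℕ)) ⁻¹' J)
      ((fun j : Fin (d + 1) => (j : ℕ)) ⁻¹' J') := Set.disjoint_left.2 fun j hj => h j hj
  exact hind.disjoint_biSup_biSup' hdis (Set.toFinite _)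

/-- `A - θ i` maps a sum of eigenspaces into itself and kills the `i`-th eigenspace. -/
theorem sub_mem_specSum_diff {J : Set ℕ} (i : Fin (d + 1)) {v : V} (hv : v ∈ specSum A θ J) :
    A v - θ i • v ∈ specSum A θ (J \ {(i : ℕ)}) := by
  suffices h : specSum A θ J ≤ (specSum A θ (J \ {(i : ℕ)})).comap (A - θ i • 1) by
    simpa using h hv
  refine specSum_le fun j hj w hw => ?_
  have hw' : A w = θ j • w := Module.End.mem_eigenspace_iff.1 hw
  rw [Submodule.mem_comap]
  by_cases hij : j = i
  · subst hij
    simp [hw']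
  · have : (A - θ i • 1) w = (θ j - θ i) • w := by simp [hw', sub_smul]
    rw [this]
    refine Submodule.smul_mem _ _ (eigenspace_le_specSum (J := J \ {(i : ℕ)}) j ⟨hj, ?_⟩ hw)
    simpa [Fin.val_inj] using hij

theorem sub_mem_specSum {J : Set ℕ} (i : Fin (d + 1)) {v : V} (hv : v ∈ specSum A θ J) :
    A v - θ i • v ∈ specSum A θ J :=
  specSum_mono (fun _ _ h => h.1) (sub_mem_specSum_diff i hv)

theorem mem_specSum_insert_of_sub_mem (hA : IsEigenOrdering A θ) {J : Set ℕ} (i : Fin (d + 1))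
    {v : V} (hv : A v - θ i • v ∈ specSum A θ J) : v ∈ specSum A θ (insert (i : ℕ) J) := by
  have htop : v ∈ specSum A θ (insert (i : ℕ) J) ⊔ specSum A θ (insert (i : ℕ) J)ᶜ := by
    rw [← specSum_union, specSum_eq_top hA (by simp)]
    trivial
  obtain ⟨u, hu, w, hw, rfl⟩ := Submodule.mem_sup.1 htop
  have hdis : Disjoint (specSum A θ (insert (i : ℕ) J)) (specSum A θ (insert (i : ℕ) J)ᶜ) :=
    disjoint_specSum hA fun j hj hj' => hj' hj
  have hw0 : A w - θ i • w = 0 := by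
    refine Submodule.disjoint_def.1 hdis _ ?_ (sub_mem_specSum i hw)
    have h1 := Submodule.sub_mem _
      (specSum_mono (J' := insert (i : ℕ) J) (fun j _ hj => Or.inr hj) hv) (sub_mem_specSum i hu)
    have h2 : A w - θ i • w = A (u + w) - θ i • (u + w) - (A u - θ i • u) := by
      rw [map_add, smul_add]
      abel
    rwa [h2]
  have hwi : w ∈ A.eigenspace (θ i) := Module.End.mem_eigenspace_iff.2 (sub_eq_zero.1 hw0)
  have : w = 0 := Submodule.disjoint_def.1 hdis _
    (eigenspace_le_specSum i (Set.mem_insert _ _) hwi) hw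
  simpa [this] using hu

theorem IsStandard.map_mem {X : Module.End 𝕂 V} (h : IsStandard A X θ) {J J' : Set ℕ}
    (hJ : ∀ i ∈ J, ∀ j, j ≤ i + 1 → i ≤ j + 1 → j ∈ J') {v : V} (hv : v ∈ specSum A θ J) :
    X v ∈ specSum A θ J' := by
  suffices hle : specSum A θ J ≤ (specSum A θ J').comap X from hle hv
  refine specSum_le fun i hi => Submodule.map_le_iff_le_comap.1 ((h i).trans ?_)
  exact iSup₂_le fun j hj => eigenspace_le_specSum j (hJ i hi j hj.1 hj.2)

theorem specSum_comp_rev (J : Set ℕ) :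
    specSum A (θ ∘ Fin.rev) J = specSum A θ {j | d - j ∈ J} := by
  apply le_antisymm
  · refine specSum_le fun j hj => eigenspace_le_specSum (Fin.rev j) ?_
    have : d - (Fin.rev j : ℕ) = j := by rw [Fin.val_rev]; omega
    rwa [Set.mem_ofPred_eq, this]
  · refine specSum_le fun j hj => ?_
    have h := eigenspace_le_specSum (A := A) (θ := θ ∘ Fin.rev) (J := J) (Fin.rev j)
      (by rw [Fin.val_rev, show d + 1 - ((j : ℕ) + 1) = d - j by omega]; exact hj)
    simpa using h

theorem IsEigenOrdering.rev (hA : IsEigenOrdering A θ) : IsEigenOrdering A (θ ∘ Fin.rev) where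
  diagonalizable := hA.diagonalizable
  injective := hA.injective.comp Fin.rev_injective
  hasEigenvalue_iff μ := by
    rw [hA.hasEigenvalue_iff]
    exact Fin.rev_surjective.exists

/-! ### Reversing the ordering of the eigenspaces -/

/-- Reversing the ordering of the eigenspaces of `A` gives another tridiagonal system; this
interchanges the two split decompositions. -/
theorem IsTDSystem.rev (h : IsTDSystem A As θ θs) : IsTDSystem A As (θ ∘ Fin.rev) θs where
  ordering := h.ordering.rev
  ordering_dual := h.ordering_dual
  standard i := by
    refine (h.standard (Fin.rev i)).trans (iSup₂_le fun j hj => ?_)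
    refine le_iSup₂_of_le (Fin.rev j) ?_ (by simp)
    rw [Fin.val_rev] at hj ⊢
    omega
  standard_dual := h.standard_dual
  irreducible := h.irreducible

theorem eigenSum_rev {m n : ℕ} (hm : m ≤ d) (hn : n ≤ d) :
    eigenSum A (θ ∘ Fin.rev) m n = eigenSum A θ (d - n) (d - m) := by
  rw [eigenSum_eq_specSum, eigenSum_eq_specSum, specSum_comp_rev]
  refine specSum_congr fun j hj => ?_
  simp only [Set.mem_ofPred_eq, Set.mem_Icc]
  omega

theorem splitU_rev {i : ℕ} (hi : i ≤ d) :
    splitU A As (θ ∘ Fin.rev) θs i = splitUDown A As θ θs i := by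
  rw [splitU, splitUDown, eigenSum_rev hi le_rfl, Nat.sub_self]

theorem kerK_rev {i : ℕ} (hi : 2 * i ≤ d) : kerK A As (θ ∘ Fin.rev) θs i = kerK A As θ θs i := by
  rw [kerK, kerK, eigenSum_rev (by omega) (by omega), Nat.sub_sub_self (by omega)]

theorem splitU_eq (i : ℕ) :
    splitU A As θ θs i = specSum As θs (Set.Iio (i + 1)) ⊓ specSum A θ (Set.Ici i) := by
  rw [splitU, eigenSum_eq_specSum, eigenSum_eq_specSum]
  congr 1
  · exact specSum_congr fun j _ => by simp only [Set.mem_Icc, Set.mem_Iio]; omega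
  · exact specSum_congr fun j _ => by simp only [Set.mem_Icc, Set.mem_Ici]; omega

/-! ### The split decomposition -/

theorem mem_kerK_of_mem_splitU {i : ℕ} {v : V} (hv : v ∈ splitU A As θ θs i)
    (hv' : v ∈ specSum A θ (Set.Icc i (d - i))) : v ∈ kerK A As θ θs i :=
  ⟨hv.1, hv'⟩

namespace IsTDSystem

theorem sub_mem_lower (h : IsTDSystem A As θ θs) {n : ℕ} (c : 𝕂) {v : V}
    (hv : v ∈ specSum As θs (Set.Iio n)) : A v - c • v ∈ specSum As θs (Set.Iio (n + 1)) := by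
  refine Submodule.sub_mem _ (h.standard_dual.map_mem (fun i hi j hj _ => ?_) hv)
    (Submodule.smul_mem _ _ (specSum_mono (fun j _ hj => ?_) hv))
  · simp only [Set.mem_Iio] at *; omega
  · simp only [Set.mem_Iio] at *; omega

theorem sub_mem_upper (i : Fin (d + 1)) {v : V}
    (hv : v ∈ specSum A θ (Set.Ici (i : ℕ))) :
    A v - θ i • v ∈ specSum A θ (Set.Ici ((i : ℕ) + 1)) := by
  refine specSum_mono (fun j _ hj => ?_) (sub_mem_specSum_diff i hv)
  simp only [Set.mem_sdiff, Set.mem_Ici, Set.mem_singleton_iff] at *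
  omega

theorem dual_sub_mem_lower (i : Fin (d + 1)) {v : V}
    (hv : v ∈ specSum As θs (Set.Iio ((i : ℕ) + 1))) :
    As v - θs i • v ∈ specSum As θs (Set.Iio (i : ℕ)) := by
  refine specSum_mono (fun j _ hj => ?_) (sub_mem_specSum_diff i hv)
  simp only [Set.mem_sdiff, Set.mem_Iio, Set.mem_singleton_iff] at *
  omega

theorem dual_sub_mem_upper (h : IsTDSystem A As θ θs) {n : ℕ} (c : 𝕂) {v : V}
    (hv : v ∈ specSum A θ (Set.Ici (n + 1))) : As v - c • v ∈ specSum A θ (Set.Ici n) := by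
  refine Submodule.sub_mem _ (h.standard.map_mem (fun i hi j hj _ => ?_) hv)
    (Submodule.smul_mem _ _ (specSum_mono (fun j _ hj => ?_) hv))
  · simp only [Set.mem_Ici] at *; omega
  · simp only [Set.mem_Ici] at *; omega

/-- For `r ≤ 1` the sum of the intersections of `V*_0 + ⋯ + V*_{n+r-1}` with `V_n + ⋯ + V_d` is
invariant under `A` and `As`. For `r = 0` it turns out to be zero, for `r = 1` it is the sum of the
first split decomposition. -/
theorem iSup_lower_inf_upper_eq (h : IsTDSystem A As θ θs) {r : ℕ} (hr : r ≤ 1) :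
    (⨆ n : ℕ, specSum As θs (Set.Iio (n + r)) ⊓ specSum A θ (Set.Ici n)) = ⊥ ∨
    (⨆ n : ℕ, specSum As θs (Set.Iio (n + r)) ⊓ specSum A θ (Set.Ici n)) = ⊤ := by
  set W := ⨆ n : ℕ, specSum As θs (Set.Iio (n + r)) ⊓ specSum A θ (Set.Ici n) with hW
  have hmem : ∀ n v, v ∈ specSum As θs (Set.Iio (n + r)) → v ∈ specSum A θ (Set.Ici n) → v ∈ W :=
    fun n v h1 h2 => le_iSup (fun n : ℕ =>
      specSum As θs (Set.Iio (n + r)) ⊓ specSum A θ (Set.Ici n)) n ⟨h1, h2⟩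
  have hzero : ∀ n v, d < n → v ∈ specSum A θ (Set.Ici n) → v = 0 := fun n v hn hv => by
    rwa [specSum_eq_bot (fun j hj => by simp only [Set.mem_Ici]; omega), Submodule.mem_bot] at hv
  refine h.irreducible W (Submodule.map_le_iff_le_comap.2 (iSup_le fun n v hv => ?_))
    (Submodule.map_le_iff_le_comap.2 (iSup_le fun n v hv => ?_))
  · obtain ⟨h1, h2⟩ := hv
    rw [Submodule.mem_comap]
    rcases lt_or_ge d n with hn | hn
    · simp [hzero n v hn h2]
    let i : Fin (d + 1) := ⟨n, by omega⟩
    have h3 : A v - θ i • v ∈ W := hmem (n + 1) _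
      (by simpa only [add_right_comm] using h.sub_mem_lower (θ i) h1) (sub_mem_upper i h2)
    simpa using W.add_mem h3 (W.smul_mem (θ i) (hmem n v h1 h2))
  · obtain ⟨h1, h2⟩ := hv
    rw [Submodule.mem_comap]
    rcases lt_or_ge d n with hn | hn
    · simp [hzero n v hn h2]
    rcases Nat.eq_zero_or_pos (n + r) with h0 | h0
    · rw [h0, specSum_eq_bot (by simp)] at h1
      simp [(Submodule.mem_bot _).1 h1]
    obtain ⟨k, hk⟩ : ∃ k, n + r = k + 1 := ⟨n + r - 1, by omega⟩
    rw [hk] at h1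
    let i : Fin (d + 1) := ⟨k, by omega⟩
    have h3 : As v - θs i • v ∈ specSum As θs (Set.Iio k) := dual_sub_mem_lower i h1
    have h4 : As v - θs i • v ∈ W := by
      rcases n with _ | m
      · rw [show k = 0 by omega, specSum_eq_bot (by simp), Submodule.mem_bot] at h3
        rw [h3]
        exact W.zero_mem
      · exact hmem m _ (by rwa [show m + r = k by omega]) (h.dual_sub_mem_upper (θs i) h2)
    simpa using W.add_mem h4 (W.smul_mem (θs i) (hmem n v (by rwa [hk]) h2))

theorem eigenspace_ne_bot (hA : IsEigenOrdering A θ) (i : Fin (d + 1)) :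
    A.eigenspace (θ i) ≠ ⊥ :=
  Module.End.hasEigenvalue_iff.1 ((hA.hasEigenvalue_iff _).2 ⟨i, rfl⟩)

theorem disjoint_lower_upper (h : IsTDSystem A As θ θs) (n : ℕ) :
    Disjoint (specSum As θs (Set.Iio n)) (specSum A θ (Set.Ici n)) := by
  -- the sum of all these intersections is invariant, and it lies in `V_1 + ⋯ + V_d`
  rw [disjoint_iff, eq_bot_iff]
  refine (le_iSup (fun n : ℕ => specSum As θs (Set.Iio (n + 0)) ⊓ specSum A θ (Set.Ici n))
    n).trans (le_of_eq ?_)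
  refine (h.iSup_lower_inf_upper_eq (Nat.zero_le 1)).resolve_right fun htop => ?_
  have hle : (⊤ : Submodule 𝕂 V) ≤ specSum A θ (Set.Ici 1) := by
    rw [← htop]
    refine iSup_le fun n => ?_
    rcases n with _ | m
    · rw [specSum_eq_bot (by simp), bot_inf_eq]
      exact bot_le
    · exact inf_le_right.trans (specSum_mono fun j _ hj => by
        simp only [Set.mem_Ici] at *; omega)
  have h0 : Disjoint (specSum A θ {0}) (specSum A θ (Set.Ici 1)) :=
    disjoint_specSum h.ordering (by simp)
  rw [top_le_iff.1 hle, disjoint_top] at h0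
  exact eigenspace_ne_bot h.ordering 0
    (eq_bot_iff.2 ((eigenspace_le_specSum 0 (by simp)).trans h0.le))

theorem iSup_splitU (h : IsTDSystem A As θ θs) : ⨆ i : ℕ, splitU A As θ θs i = ⊤ := by
  simp only [splitU_eq]
  -- the sum is nonzero, since `U 0 = V*_0`
  refine (h.iSup_lower_inf_upper_eq le_rfl).resolve_left fun hbot => ?_
  have hle : As.eigenspace (θs 0) ≤ ⊥ := by
    rw [← hbot]
    refine le_iSup_of_le 0 (le_inf (eigenspace_le_specSum 0 (by simp)) ?_)
    rw [specSum_eq_top h.ordering (by simp)]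
    exact le_top
  exact eigenspace_ne_bot h.ordering_dual 0 (eq_bot_iff.2 hle)

/-- `V` is the direct sum of `V*_0 + ⋯ + V*_{n-1}` and `V_n + ⋯ + V_d`. -/
theorem isCompl_lower_upper (h : IsTDSystem A As θ θs) (n : ℕ) :
    IsCompl (specSum As θs (Set.Iio n)) (specSum A θ (Set.Ici n)) := by
  refine ⟨h.disjoint_lower_upper n, codisjoint_iff_le_sup.2 ?_⟩
  rw [← h.iSup_splitU]
  refine iSup_le fun i => ?_
  rw [splitU_eq]
  rcases lt_or_ge i n with hi | hi
  · exact le_sup_of_le_left (inf_le_left.trans (specSum_mono fun j _ hj => by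
      simp only [Set.mem_Iio] at *; omega))
  · exact le_sup_of_le_right (inf_le_right.trans (specSum_mono fun j _ hj => by
      simp only [Set.mem_Ici] at *; omega))

/-- The complement property for the reversed ordering: `V` is the direct sum of
`V*_0 + ⋯ + V*_{n-1}` and `V_0 + ⋯ + V_{d-n}`. -/
theorem isCompl_lower_initial (h : IsTDSystem A As θ θs) {m n : ℕ} (hmn : m + n = d + 1) :
    IsCompl (specSum As θs (Set.Iio n)) (specSum A θ (Set.Iio m)) := by
  have := h.rev.isCompl_lower_upper n
  rw [specSum_comp_rev] at this
  rwa [specSum_congr (J := Set.Iio m) (J' := {j | d - j ∈ Set.Ici n}) fun j hj => by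
    simp only [Set.mem_Iio, Set.mem_ofPred_eq, Set.mem_Ici]; omega]

theorem sup_splitU (h : IsTDSystem A As θ θs) (i : ℕ) :
    specSum As θs (Set.Iio i) ⊔ splitU A As θ θs i = specSum As θs (Set.Iio (i + 1)) := by
  have hle : specSum As θs (Set.Iio i) ≤ specSum As θs (Set.Iio (i + 1)) :=
    specSum_mono fun j _ hj => by simp only [Set.mem_Iio] at *; omega
  rw [splitU_eq, inf_comm, ← sup_inf_assoc_of_le _ hle, (h.isCompl_lower_upper i).sup_eq_top,
    top_inf_eq]

theorem disjoint_splitU (h : IsTDSystem A As θ θs) (i : ℕ) :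
    Disjoint (specSum As θs (Set.Iio i)) (splitU A As θ θs i) := by
  rw [splitU_eq]
  exact (h.disjoint_lower_upper i).mono_right inf_le_right

theorem sub_mem_splitU (h : IsTDSystem A As θ θs) (i : Fin (d + 1)) {v : V}
    (hv : v ∈ splitU A As θ θs i) : A v - θ i • v ∈ splitU A As θ θs ((i : ℕ) + 1) := by
  rw [splitU_eq] at hv ⊢
  exact ⟨h.sub_mem_lower (θ i) hv.1, sub_mem_upper i hv.2⟩

theorem splitU_eq_bot {i : ℕ} (hi : d < i) : splitU A As θ θs i = ⊥ := by
  rw [splitU_eq, specSum_eq_bot (J := Set.Ici i) fun j hj => by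
    simp only [Set.mem_Ici]; omega, inf_bot_eq]

/-! ### Dimensions and generation by the `K_i` -/

/-- The `i`-th component of the split decomposition has the dimension of the `(d - i)`-th one:
both orderings of the eigenspaces of `A` give a split decomposition with the same lower flag. -/
theorem finrank_splitU_symm [FiniteDimensional 𝕂 V] (h : IsTDSystem A As θ θs) {i j : ℕ}
    (hij : i + j = d) :
    Module.finrank 𝕂 (splitU A As θ θs i) = Module.finrank 𝕂 (splitU A As θ θs j) := by
  have hdim : ∀ k, Module.finrank 𝕂 (specSum As θs (Set.Iio (k + 1))) =
      Module.finrank 𝕂 (specSum As θs (Set.Iio k)) +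
        Module.finrank 𝕂 (splitU A As θ θs k) := fun k => by
    have := Submodule.finrank_sup_add_finrank_inf_eq (specSum As θs (Set.Iio k))
      (splitU A As θ θs k)
    rwa [h.sup_splitU, (h.disjoint_splitU k).eq_bot, finrank_bot, add_zero] at this
  have hlow : ∀ m n, m + n = d + 1 → Module.finrank 𝕂 (specSum As θs (Set.Iio n)) +
      Module.finrank 𝕂 (specSum As θs (Set.Iio m)) = Module.finrank 𝕂 V := fun m n hmn => by
    have h1 := Submodule.finrank_add_eq_of_isCompl (h.isCompl_lower_initial hmn)
    have h2 := Submodule.finrank_add_eq_of_isCompl (h.isCompl_lower_upper m)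
    have h3 : IsCompl (specSum A θ (Set.Iio m)) (specSum A θ (Set.Ici m)) :=
      ⟨disjoint_specSum h.ordering (by simp), codisjoint_iff.2 (by
        rw [← specSum_union, specSum_eq_top h.ordering fun j _ => by
          simp only [Set.mem_union, Set.mem_Iio, Set.mem_Ici]; omega])⟩
    have h4 := Submodule.finrank_add_eq_of_isCompl h3
    omega
  have h1 := hdim i
  have h2 := hdim j
  have h3 := hlow i (j + 1) (by omega)
  have h4 := hlow j (i + 1) (by omega)
  omega

/-- The product `(A - θ (i + k - 1)) ⋯ (A - θ (i + 1)) (A - θ i)`, which maps `U i` to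
`U (i + k)`. It is only used for `i + k ≤ d + 1`; beyond that the indices are reduced modulo
`d + 1`. -/
def shift (A : Module.End 𝕂 V) (θ : Fin (d + 1) → 𝕂) (i : ℕ) : ℕ → Module.End 𝕂 V
  | 0 => 1
  | k + 1 => (A - θ (Fin.ofNat (d + 1) (i + k)) • 1) * shift A θ i k

theorem shift_succ' (i k : ℕ) :
    shift A θ i (k + 1) = shift A θ (i + 1) k * (A - θ (Fin.ofNat (d + 1) i) • 1) := by
  induction k with
  | zero => simp [shift]
  | succ k ih => rw [shift, ih, shift, mul_assoc, add_right_comm, add_assoc i k 1]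

theorem shift_mem_splitU (h : IsTDSystem A As θ θs) {i k : ℕ} (hik : i + k ≤ d + 1) {v : V}
    (hv : v ∈ splitU A As θ θs i) : shift A θ i k v ∈ splitU A As θ θs (i + k) := by
  induction k with
  | zero => simpa [shift] using hv
  | succ k ih =>
    have hval : ((Fin.ofNat (d + 1) (i + k) : Fin (d + 1)) : ℕ) = i + k :=
      Nat.mod_eq_of_lt (by omega)
    have := h.sub_mem_splitU (Fin.ofNat (d + 1) (i + k)) (by rw [hval]; exact ih (by omega))
    rw [hval] at this
    simpa [shift, add_assoc] using this

/-- The kernel of `shift A θ i k` is contained in `V_i + ⋯ + V_{i+k-1}`. -/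
theorem mem_specSum_of_shift_eq_zero (hA : IsEigenOrdering A θ) {i k : ℕ} (hik : i + k ≤ d + 1)
    {v : V} (hv : shift A θ i k v = 0) : v ∈ specSum A θ (Set.Ico i (i + k)) := by
  induction k generalizing i v with
  | zero =>
    have : v = 0 := by simpa [shift] using hv
    rw [this]
    exact Submodule.zero_mem _
  | succ k ih =>
    rw [shift_succ'] at hv
    have h1 := ih (i := i + 1) (by omega) hv
    have h2 := mem_specSum_insert_of_sub_mem hA (Fin.ofNat (d + 1) i) (by simpa using h1)
    have hval : ((Fin.ofNat (d + 1) i : Fin (d + 1)) : ℕ) = i := Nat.mod_eq_of_lt (by omega)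
    rw [hval] at h2
    refine specSum_mono (fun j _ hj => ?_) h2
    simp only [Set.mem_insert_iff, Set.mem_Ico] at *
    omega

/-- The analogue of the hard Lefschetz property: `shift` is a bijection from `U i` onto
`U (d - i)`, for `2 i ≤ d`. -/
theorem exists_shift_eq [FiniteDimensional 𝕂 V] (h : IsTDSystem A As θ θs) {i k : ℕ}
    (hik : 2 * i + k = d) {w : V} (hw : w ∈ splitU A As θ θs (i + k)) :
    ∃ u ∈ splitU A As θ θs i, shift A θ i k u = w := by
  let f : splitU A As θ θs i →ₗ[𝕂] splitU A As θ θs (i + k) :=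
    (shift A θ i k).restrict fun v hv => h.shift_mem_splitU (by omega) hv
  have hinj : Function.Injective f := by
    refine (injective_iff_map_eq_zero f).2 fun v hv => Subtype.ext ?_
    have h0 : shift A θ i k v = 0 := congrArg Subtype.val hv
    have h1 := mem_specSum_of_shift_eq_zero h.ordering (by omega) h0
    have h2 : (v : V) ∈ specSum As θs (Set.Iio (i + 1)) ⊓ specSum A θ (Set.Ici i) :=
      splitU_eq (A := A) (As := As) (θ := θ) (θs := θs) i ▸ v.2
    refine Submodule.disjoint_def.1
      (h.isCompl_lower_initial (m := i + k) (n := i + 1) (by omega)).disjoint _ h2.1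
      (specSum_mono (fun j _ hj => hj.2) h1)
  have hsurj := (LinearMap.injective_iff_surjective_of_finrank_eq_finrank
    (h.finrank_splitU_symm (i := i) (j := i + k) (by omega))).1 hinj
  obtain ⟨u, hu⟩ := hsurj ⟨w, hw⟩
  exact ⟨u, u.2, congrArg Subtype.val hu⟩

/-- `V` is generated by the subspaces `K_i` under the raising maps `A - θ i : U i → U (i + 1)`. -/
theorem eq_top_of_kerK_le [FiniteDimensional 𝕂 V] (h : IsTDSystem A As θ θs)
    {Z : Submodule 𝕂 V} (hK : ∀ i, 2 * i ≤ d → kerK A As θ θs i ≤ Z)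
    (hZ : ∀ (i : Fin (d + 1)), ∀ v ∈ splitU A As θ θs i, v ∈ Z → A v - θ i • v ∈ Z) : Z = ⊤ := by
  have key : ∀ i ≤ d, splitU A As θ θs i ≤ Z := by
    intro i
    induction i with
    | zero => exact fun _ => hK 0 (by omega)
    | succ i ih =>
      intro hi v hv
      let t : Fin (d + 1) := ⟨i, by omega⟩
      have ht : Fin.ofNat (d + 1) i = t := Fin.ext (Nat.mod_eq_of_lt (by omega))
      have hstep : ∀ u ∈ splitU A As θ θs i, A u - θ t • u ∈ Z := fun u hu =>
        hZ t u hu (ih (by omega) hu)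
      by_cases h2 : 2 * (i + 1) ≤ d
      · -- subtract from `v` an element of the image of `U i` with the same image in `U (d - i)`
        obtain ⟨k, hk⟩ : ∃ k, 2 * i + (k + 1) = d := ⟨d - 2 * i - 1, by omega⟩
        have h3 := h.shift_mem_splitU (k := k) (by omega) hv
        rw [add_assoc, add_comm 1 k] at h3
        obtain ⟨u, hu, huv⟩ := h.exists_shift_eq hk h3
        rw [shift_succ', ht] at huv
        have h4 : shift A θ (i + 1) k (v - (A u - θ t • u)) = 0 := by
          rw [map_sub, sub_eq_zero, ← huv]
          simp
        have h5 : v - (A u - θ t • u) ∈ kerK A As θ θs (i + 1) := by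
          have h6 : v - (A u - θ t • u) ∈ splitU A As θ θs (i + 1) :=
            Submodule.sub_mem _ hv (h.sub_mem_splitU t hu)
          refine mem_kerK_of_mem_splitU h6 (specSum_mono (fun j _ hj => ?_)
            (mem_specSum_of_shift_eq_zero h.ordering (by omega) h4))
          simp only [Set.mem_Ico, Set.mem_Icc] at *
          omega
        simpa using Z.add_mem (hK _ h2 h5) (hstep u hu)
      · obtain ⟨m, k, hm, hmk⟩ : ∃ m k, 2 * m + (k + 1) = d ∧ m + (k + 1) = i + 1 :=
          ⟨d - (i + 1), 2 * (i + 1) - d - 1, by omega, by omega⟩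
        -- `U (i + 1)` is an image of `U m` for some `m ≤ i`, and the last factor of the product
        -- acts on an element of `U i`
        obtain ⟨u, hu, rfl⟩ := h.exists_shift_eq hm (w := v) (by rwa [hmk])
        have h3 := h.shift_mem_splitU (k := k) (by omega) hu
        rw [show m + k = i by omega] at h3
        have := hstep _ h3
        rw [shift, show m + k = i by omega, ht]
        simpa using this
  rw [eq_top_iff, ← h.iSup_splitU]
  refine iSup_le fun i => ?_
  rcases le_or_gt i d with hi | hi
  · exact key i hi
  · rw [splitU_eq_bot hi]
    exact bot_le

/-! ### Maps acting by weights on the split decomposition -/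

theorem ext_splitU (h : IsTDSystem A As θ θs) {X Y : Module.End 𝕂 V}
    (hXY : ∀ i ≤ d, ∀ v ∈ splitU A As θ θs i, X v = Y v) : X = Y := by
  refine LinearMap.eqLocus_eq_top.1 (eq_top_iff.2 ?_)
  rw [← h.iSup_splitU]
  refine iSup_le fun i v hv => ?_
  rcases le_or_gt i d with hi | hi
  · exact hXY i hi v hv
  · rw [splitU_eq_bot hi, Submodule.mem_bot] at hv
    simp [hv]

/-- The map acting on `U i` as the scalar `w i`, built from the projections onto the lower flag
along the upper flag. -/
theorem exists_acts (h : IsTDSystem A As θ θs) (w : ℕ → 𝕂) :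
    ∃ X : Module.End 𝕂 V, ∀ i, ∀ v ∈ splitU A As θ θs i, X v = w i • v := by
  let P : ℕ → Module.End 𝕂 V := fun n =>
    Submodule.projection _ _ (h.isCompl_lower_upper n)
  refine ⟨∑ n ∈ Finset.range (d + 1), w n • (P (n + 1) - P n), fun i v hv => ?_⟩
  rcases lt_or_ge d i with hi | hi
  · rw [splitU_eq_bot hi, Submodule.mem_bot] at hv
    simp [hv]
  rw [splitU_eq] at hv
  have h1 : ∀ n, i < n → P n v = v := fun n hn =>
    (Submodule.projection_eq_self_iff (h.isCompl_lower_upper n) v).2 (specSum_mono (fun j _ hj => by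
      simp only [Set.mem_Iio] at *; omega) hv.1)
  have h2 : ∀ n, n ≤ i → P n v = 0 := fun n hn =>
    (Submodule.projection_apply_eq_zero_iff (h.isCompl_lower_upper n)).2 (specSum_mono (fun j _ hj => by
      simp only [Set.mem_Ici] at *; omega) hv.2)
  rw [LinearMap.sum_apply, Finset.sum_eq_single i]
  · simp [h1 (i + 1) (by omega), h2 i le_rfl]
  · intro n _ hn
    rcases lt_or_gt_of_ne hn with hn | hn
    · simp [h2 n (by omega), h2 (n + 1) (by omega)]
    · simp [h1 n (by omega), h1 (n + 1) (by omega)]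
  · exact fun hn => absurd (Finset.mem_range.2 (by omega)) hn

/-- A map that acts on each `U i` as a scalar `w i` preserves the flag `V*_0 + ⋯ + V*_{n-1}` and
acts on its `n`-th quotient as `w n`. -/
theorem acts_sub_mem_lower (h : IsTDSystem A As θ θs) {w : ℕ → 𝕂} {X : Module.End 𝕂 V}
    (hX : ∀ i, ∀ v ∈ splitU A As θ θs i, X v = w i • v) (n : ℕ) :
    (∀ v ∈ specSum As θs (Set.Iio n), X v ∈ specSum As θs (Set.Iio n)) ∧
    ∀ v ∈ specSum As θs (Set.Iio (n + 1)), X v - w n • v ∈ specSum As θs (Set.Iio n) := by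
  have hstep : ∀ n, (∀ v ∈ specSum As θs (Set.Iio n), X v ∈ specSum As θs (Set.Iio n)) →
      ∀ v ∈ specSum As θs (Set.Iio (n + 1)), X v - w n • v ∈ specSum As θs (Set.Iio n) := by
    intro n hn v hv
    rw [← h.sup_splitU] at hv
    obtain ⟨f, hf, u, hu, rfl⟩ := Submodule.mem_sup.1 hv
    have : X (f + u) - w n • (f + u) = X f - w n • f := by
      rw [map_add, hX n u hu, smul_add]
      abel
    rw [this]
    exact Submodule.sub_mem _ (hn f hf) (Submodule.smul_mem _ _ hf)
  have hinv : ∀ n, ∀ v ∈ specSum As θs (Set.Iio n), X v ∈ specSum As θs (Set.Iio n) := by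
    intro n
    induction n with
    | zero =>
      intro v hv
      rw [specSum_eq_bot (by simp), Submodule.mem_bot] at hv ⊢
      simp [hv]
    | succ n ih =>
      intro v hv
      have h1 : X v - w n • v ∈ specSum As θs (Set.Iio (n + 1)) :=
        specSum_mono (fun j _ hj => by simp only [Set.mem_Iio] at *; omega) (hstep n ih v hv)
      simpa using Submodule.add_mem _ h1 (Submodule.smul_mem _ (w n) hv)
  exact ⟨hinv n, hstep n (hinv n)⟩

/-- The invertible map that acts on the split decomposition with weights `q ^ (d - 2 i)`, and the
`q`-Weyl type relation between this map and `A`. -/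
theorem exists_weight_unit (h : IsTDSystem A As θ θs) {q a : 𝕂} (hq : q ≠ 0) (ha : a ≠ 0)
    (hθ : ∀ i : Fin (d + 1), θ i =
      a * q ^ ((d : ℤ) - 2 * ((i : ℕ) : ℤ)) + a⁻¹ * q ^ (2 * ((i : ℕ) : ℤ) - (d : ℤ))) :
    ∃ K : (Module.End 𝕂 V)ˣ,
      (∀ i, ∀ v ∈ splitU A As θ θs i,
        (K : Module.End 𝕂 V) v = q ^ ((d : ℤ) - 2 * (i : ℤ)) • v) ∧
      (∀ i, ∀ v ∈ splitU A As θ θs i,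
        (↑K⁻¹ : Module.End 𝕂 V) v = q ^ (2 * (i : ℤ) - (d : ℤ)) • v) ∧
      (K : Module.End 𝕂 V) * A = (q ^ 2)⁻¹ • (A * (K : Module.End 𝕂 V)) +
        (1 - (q ^ 2)⁻¹) • (a • ((K : Module.End 𝕂 V) * (K : Module.End 𝕂 V)) + a⁻¹ • 1) := by
  obtain ⟨X, hX⟩ := h.exists_acts fun i => q ^ ((d : ℤ) - 2 * (i : ℤ))
  obtain ⟨Y, hY⟩ := h.exists_acts fun i => q ^ (2 * (i : ℤ) - (d : ℤ))
  have hw : ∀ i : ℕ, q ^ ((d : ℤ) - 2 * (i : ℤ)) * q ^ (2 * (i : ℤ) - (d : ℤ)) = 1 := fun i => by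
    rw [← zpow_add₀ hq, show (d : ℤ) - 2 * (i : ℤ) + (2 * (i : ℤ) - (d : ℤ)) = 0 by ring, zpow_zero]
  have hXY : X * Y = 1 := h.ext_splitU fun i _ v hv => by
    rw [Module.End.mul_apply, hY i v hv, map_smul, hX i v hv, smul_smul, mul_comm, hw, one_smul,
      Module.End.one_apply]
  have hYX : Y * X = 1 := h.ext_splitU fun i _ v hv => by
    rw [Module.End.mul_apply, hX i v hv, map_smul, hY i v hv, smul_smul, hw, one_smul,
      Module.End.one_apply]
  refine ⟨⟨X, Y, hXY, hYX⟩, hX, hY, h.ext_splitU fun i hi v hv => ?_⟩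
  let t : Fin (d + 1) := ⟨i, by omega⟩
  obtain ⟨u, hu⟩ : ∃ u, u = A v - θ t • v := ⟨_, rfl⟩
  have hXu : X u = q ^ ((d : ℤ) - 2 * ((i + 1 : ℕ) : ℤ)) • u :=
    hX (i + 1) u (hu ▸ h.sub_mem_splitU t hv)
  have hAv : A v = u + θ t • v := by rw [hu]; abel
  have hs : q ^ ((d : ℤ) - 2 * ((i + 1 : ℕ) : ℤ)) = q ^ ((d : ℤ) - 2 * (i : ℤ)) * (q ^ 2)⁻¹ := by
    rw [show (d : ℤ) - 2 * ((i + 1 : ℕ) : ℤ) = (d - 2 * (i : ℤ)) - (2 : ℕ) by push_cast; ring,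
      zpow_sub₀ hq, zpow_natCast, div_eq_mul_inv]
  have ht := hθ t
  rw [show ((t : ℕ) : ℤ) = (i : ℤ) from rfl, eq_inv_of_mul_eq_one_right (hw i)] at ht
  have hκ : q ^ ((d : ℤ) - 2 * (i : ℤ)) ≠ 0 := zpow_ne_zero _ hq
  simp only [Module.End.mul_apply, LinearMap.add_apply, LinearMap.smul_apply,
    Module.End.one_apply, hX i v hv, hAv, map_add, map_smul, hXu, hs, ht]
  generalize q ^ ((d : ℤ) - 2 * (i : ℤ)) = κ at hκ
  match_scalars <;> field_simp
  ring

end IsTDSystem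
end TD

namespace TD

/-! ### Algebraic relations between `A`, `K`, `B` and `ψ` -/

section Algebra

variable {𝕂 E : Type*} [Field 𝕂] [Ring E] [Algebra 𝕂 E]

/-- The quadratic expression in `K` and `B` whose vanishing makes the Möbius transform of
`K⁻¹ * B` that defines `ψ` lower the weights of `K` by two steps. -/
def quadraticDefect (q a : 𝕂) (K B : E) : E :=
  q ^ 2 • ((K - B) * (a • K - a⁻¹ • B)) - (a • K - a⁻¹ • B) * (K - B)

/-- If `K` and `B` satisfy `q`-Weyl type relations with `A` for the parameters `a` and `a⁻¹`, then
moving `A` to the left of the quadratic defect leaves an error in the two-sided ideal it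
generates. -/
theorem quadraticDefect_mul {q a : 𝕂} (hq : q ≠ 0) (ha : a ≠ 0) (ha2 : a ^ 2 ≠ 1) {A K B : E}
    (hK : K * A = (q ^ 2)⁻¹ • (A * K) + (1 - (q ^ 2)⁻¹) • (a • (K * K) + a⁻¹ • 1))
    (hB : B * A = (q ^ 2)⁻¹ • (A * B) + (1 - (q ^ 2)⁻¹) • (a⁻¹ • (B * B) + a • 1)) :
    ∃ L M : E, (∃ z w : 𝕂, M = z • K + w • B) ∧
      quadraticDefect q a K B * A = (q ^ 4)⁻¹ • (A * quadraticDefect q a K B) +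
        (L * quadraticDefect q a K B + quadraticDefect q a K B * M) := by
  have hK' : ∀ X, K * (A * X) = (q ^ 2)⁻¹ • (A * (K * X)) +
      (1 - (q ^ 2)⁻¹) • (a • (K * (K * X)) + a⁻¹ • X) := fun X => by
    rw [← mul_assoc, hK]
    simp only [add_mul, smul_mul_assoc, one_mul, mul_assoc]
  have hB' : ∀ X, B * (A * X) = (q ^ 2)⁻¹ • (A * (B * X)) +
      (1 - (q ^ 2)⁻¹) • (a⁻¹ • (B * (B * X)) + a • X) := fun X => by
    rw [← mul_assoc, hB]
    simp only [add_mul, smul_mul_assoc, one_mul, mul_assoc]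
  have hne : 1 - a ^ 2 ≠ 0 := sub_ne_zero.2 (Ne.symm ha2)
  -- The coefficients solve the linear system obtained by comparing the cubic words in `K` and `B`.
  let e : 𝕂 := (1 - (q ^ 2)⁻¹) * q⁻¹ * a / (1 - a ^ 2)
  let β : 𝕂 := a * q⁻¹ - a⁻¹ * q
  let γ : 𝕂 := a⁻¹ * q⁻¹ - a * q
  refine ⟨(-(e * β * a)) • K + (e * γ * a⁻¹) • B, (e * γ * a) • K + (-(e * β * a⁻¹)) • B,
    ⟨_, _, rfl⟩, ?_⟩
  simp only [quadraticDefect, sub_mul, mul_sub, add_mul, mul_add, smul_mul_assoc, mul_smul_comm,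
    mul_assoc, hK, hB, hK', hB', smul_add, smul_sub, mul_one]
  match_scalars <;> (try simp only [e, β, γ]) <;> field_simp <;> ring

/-- The Möbius transform `ψ = q (1 - y) / (a - a⁻¹ y)` of an element `y` with `1 - y` nilpotent. -/
theorem exists_moebius {q a : 𝕂} (ha : a ≠ 0) (ha2 : a ^ 2 ≠ 1) {y : E} {n : ℕ}
    (hy : (1 - y) ^ n = 0) :
    ∃ (u : Eˣ) (ψ : E), (u : E) = a • 1 - a⁻¹ • y ∧ u * ψ = q • (1 - y) ∧
      ψ * u = q • (1 - y) ∧ ψ ^ n = 0 := by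
  have hne : a - a⁻¹ ≠ 0 := by
    intro h
    apply ha2
    field_simp at h
    linear_combination h
  have hu : IsUnit (a • (1 : E) - a⁻¹ • y) := by
    have h1 : a • (1 : E) - a⁻¹ • y = (a - a⁻¹) • 1 + a⁻¹ • (1 - y) := by module
    rw [h1]
    have h2 : IsUnit ((a - a⁻¹) • (1 : E)) := by
      rw [← Algebra.algebraMap_eq_smul_one]
      exact (IsUnit.mk0 _ hne).map _
    have h3 : IsNilpotent (a⁻¹ • (1 - y)) := ⟨n, by rw [smul_pow, hy, smul_zero]⟩
    exact h3.isUnit_add_left_of_commute h2 ((Commute.one_right _).smul_right _)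
  obtain ⟨u, hu⟩ := hu
  have hc : Commute (1 - y) (u : E) := by
    rw [hu]
    have : Commute (1 - y) y := (Commute.one_left y).sub_left (Commute.refl y)
    exact ((Commute.one_right _).smul_right a).sub_right (this.smul_right _)
  have hc' : Commute (1 - y) (↑u⁻¹ : E) := hc.units_inv_right
  refine ⟨u, q • ((1 - y) * ↑u⁻¹), hu, ?_, ?_, ?_⟩
  · rw [mul_smul_comm, hc'.eq, Units.mul_inv_cancel_left]
  · rw [smul_mul_assoc, Units.inv_mul_cancel_right]
  · rw [smul_pow, hc'.mul_pow, hy, zero_mul, smul_zero]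

variable {q a : 𝕂} {A ψ : E} {K B u : Eˣ}

/-- The Möbius transform `ψ` of `K⁻¹ * B` satisfies `K ψ = q² ψ K`, once the quadratic defect
vanishes: with `u = a - a⁻¹ K⁻¹ B`, `q` times the defect is `K u (q² ψ K - K ψ) u`. -/
theorem mul_eq_of_quadraticDefect_eq_zero
    (hu : (u : E) = a • 1 - a⁻¹ • (↑K⁻¹ * (B : E)))
    (h1 : u * ψ = q • (1 - ↑K⁻¹ * (B : E))) (h2 : ψ * u = q • (1 - ↑K⁻¹ * (B : E)))
    (hQ : quadraticDefect q a (K : E) (B : E) = 0) :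
    (K : E) * ψ = q ^ 2 • (ψ * (K : E)) := by
  have h3 : q • ((K : E) - B) = K * (u * ψ) := by
    rw [h1, mul_smul_comm, mul_sub, mul_one, Units.mul_inv_cancel_left]
  have h4 : q • ((K : E) - B) = K * (ψ * u) := by
    rw [h2, mul_smul_comm, mul_sub, mul_one, Units.mul_inv_cancel_left]
  have h5 : a • (K : E) - a⁻¹ • (B : E) = K * u := by
    rw [hu, mul_sub, mul_smul_comm, mul_smul_comm, mul_one, Units.mul_inv_cancel_left]
  have h6 : q • quadraticDefect q a (K : E) (B : E) =
      q ^ 2 • ((q • ((K : E) - B)) * (a • (K : E) - a⁻¹ • (B : E))) -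
        (a • (K : E) - a⁻¹ • (B : E)) * (q • ((K : E) - B)) := by
    rw [quadraticDefect, smul_sub, smul_mul_assoc, mul_smul_comm, smul_comm q (q ^ 2)]
  rw [hQ, smul_zero, h5] at h6
  nth_rw 1 [h3] at h6
  rw [h4] at h6
  have h7 : (K : E) * u * ((q ^ 2 • (ψ * K) - K * ψ) * u) = 0 := by
    rw [h6]
    simp only [mul_sub, sub_mul, mul_smul_comm, smul_mul_assoc, mul_assoc]
  rw [← Units.val_mul, Units.mul_right_eq_zero, Units.mul_left_eq_zero, sub_eq_zero] at h7
  exact h7.symm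

theorem mul_one_sub_eq (hq : q ≠ 0) (ha : a ≠ 0)
    (hu : (u : E) = a • 1 - a⁻¹ • (↑K⁻¹ * (B : E)))
    (h1 : u * ψ = q • (1 - ↑K⁻¹ * (B : E))) :
    (B : E) * (1 - (a⁻¹ * q⁻¹) • ψ) = K * (1 - (a * q⁻¹) • ψ) := by
  have h2 : a • ((K : E) * ψ) - a⁻¹ • ((B : E) * ψ) = q • ((K : E) - B) := by
    have h3 : (K : E) * (u * ψ) = q • ((K : E) - B) := by
      rw [h1, mul_smul_comm, mul_sub, mul_one, Units.mul_inv_cancel_left]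
    rw [← h3, hu]
    simp only [sub_mul, mul_sub, smul_mul_assoc, mul_smul_comm, one_mul, mul_assoc,
      Units.mul_inv_cancel_left]
  have h3 : (K : E) * (1 - (a * q⁻¹) • ψ) - (B : E) * (1 - (a⁻¹ * q⁻¹) • ψ) =
      q⁻¹ • (q • ((K : E) - B) - (a • ((K : E) * ψ) - a⁻¹ • ((B : E) * ψ))) := by
    simp only [mul_sub, mul_smul_comm, mul_one]
    match_scalars <;> field_simp
  rw [h2, sub_self, smul_zero, sub_eq_zero] at h3
  exact h3.symm

theorem one_sub_mul_eq
    (hu : (u : E) = a • 1 - a⁻¹ • (↑K⁻¹ * (B : E))) (hq : q ≠ 0) (ha : a ≠ 0)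
    (h2 : ψ * u = q • (1 - ↑K⁻¹ * (B : E))) :
    (1 - (a⁻¹ * q⁻¹) • ψ) * (↑K⁻¹ * (B : E)) = 1 - (a * q⁻¹) • ψ := by
  rw [hu, mul_sub, mul_smul_comm, mul_smul_comm, mul_one] at h2
  have h3 : (1 - (a * q⁻¹) • ψ) - (1 - (a⁻¹ * q⁻¹) • ψ) * (↑K⁻¹ * (B : E)) =
      q⁻¹ • (q • (1 - ↑K⁻¹ * (B : E)) - (a • ψ - a⁻¹ • (ψ * (↑K⁻¹ * (B : E))))) := by
    simp only [sub_mul, smul_mul_assoc, one_mul]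
    match_scalars <;> field_simp
  rw [h2, sub_self, smul_zero, sub_eq_zero] at h3
  exact h3.symm

/-- The relation between `K⁻¹` and `B⁻¹`; moving `ψ` past `K⁻¹` turns `q⁻¹` into `q`. -/
theorem inv_mul_one_sub_eq (hq : q ≠ 0) (hψ : (K : E) * ψ = q ^ 2 • (ψ * (K : E)))
    (h : (B : E) * (1 - (a⁻¹ * q⁻¹) • ψ) = K * (1 - (a * q⁻¹) • ψ)) :
    (↑B⁻¹ : E) * (1 - (a * q) • ψ) = ↑K⁻¹ * (1 - (a⁻¹ * q) • ψ) := by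
  have hψ' : ψ * (↑K⁻¹ : E) = q ^ 2 • (↑K⁻¹ * ψ) := by
    have := congrArg (fun X => (↑K⁻¹ : E) * X * ↑K⁻¹) hψ
    simpa [mul_assoc] using this
  have hc : ∀ c : 𝕂, (1 - (c * q⁻¹) • ψ) * (↑K⁻¹ : E) = ↑K⁻¹ * (1 - (c * q) • ψ) := fun c => by
    simp only [sub_mul, mul_sub, smul_mul_assoc, mul_smul_comm, hψ', one_mul, mul_one, smul_smul]
    congr 2
    field_simp
  have h3 := congrArg (fun X => (↑B⁻¹ : E) * (X * ↑K⁻¹)) h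
  simp only [mul_assoc, hc, Units.inv_mul_cancel_left] at h3
  rw [h3, ← mul_assoc (K : E), Units.mul_inv, one_mul]

/-- The relation between `ψ` and `R = A - a K - a⁻¹ K⁻¹` is the `q`-Weyl type relation between `B`
and `A`, rewritten through `K⁻¹ B = (1 - a q⁻¹ ψ) / (1 - a⁻¹ q⁻¹ ψ)`. -/
theorem commutator_eq (hq : q ≠ 0) (ha : a ≠ 0) (ha2 : a ^ 2 ≠ 1)
    (hK : (K : E) * A = (q ^ 2)⁻¹ • (A * (K : E)) +
      (1 - (q ^ 2)⁻¹) • (a • ((K : E) * (K : E)) + a⁻¹ • 1))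
    (hB : (B : E) * A = (q ^ 2)⁻¹ • (A * (B : E)) +
      (1 - (q ^ 2)⁻¹) • (a⁻¹ • ((B : E) * (B : E)) + a • 1))
    (hψ : (K : E) * ψ = q ^ 2 • (ψ * (K : E)))
    (h1 : (B : E) * (1 - (a⁻¹ * q⁻¹) • ψ) = K * (1 - (a * q⁻¹) • ψ))
    (h2 : (1 - (a⁻¹ * q⁻¹) • ψ) * (↑K⁻¹ * (B : E)) = 1 - (a * q⁻¹) • ψ) :
    ψ * (A - a • (K : E) - a⁻¹ • ↑K⁻¹) - (A - a • (K : E) - a⁻¹ • ↑K⁻¹) * ψ =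
      (q - q⁻¹) • ((K : E) - ↑K⁻¹) := by
  have hψ1 : ψ * (K : E) = (q ^ 2)⁻¹ • ((K : E) * ψ) := by
    rw [hψ, smul_smul, inv_mul_cancel₀ (pow_ne_zero 2 hq), one_smul]
  have hψ2 : ψ * (↑K⁻¹ : E) = q ^ 2 • (↑K⁻¹ * ψ) := by
    have := congrArg (fun X => (↑K⁻¹ : E) * X * ↑K⁻¹) hψ
    simpa [mul_assoc] using this
  obtain ⟨R, hR⟩ : ∃ R, R = A - a • (K : E) - a⁻¹ • (↑K⁻¹ : E) := ⟨_, rfl⟩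
  have hA : A = R + a • (K : E) + a⁻¹ • (↑K⁻¹ : E) := by rw [hR]; abel
  -- conjugating `A` by `K` only rescales `R`
  have hconj : (↑K⁻¹ : E) * (A * K) = q ^ 2 • R + a • (K : E) + a⁻¹ • (↑K⁻¹ : E) := by
    have h3 : A * (K : E) = q ^ 2 • ((K : E) * A) -
        (q ^ 2 - 1) • (a • ((K : E) * (K : E)) + a⁻¹ • 1) := by
      rw [hK]
      match_scalars <;> field_simp <;> ring
    rw [h3, hR]
    simp only [mul_sub, mul_add, mul_smul_comm, Units.inv_mul_cancel_left, mul_one]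
    match_scalars <;> ring
  obtain ⟨N, hN⟩ : ∃ N, N = 1 - (a⁻¹ * q⁻¹) • ψ := ⟨_, rfl⟩
  obtain ⟨M, hM⟩ : ∃ M, M = 1 - (a * q⁻¹) • ψ := ⟨_, rfl⟩
  rw [← hN, ← hM] at h1 h2
  -- multiply the relation for `B` by `N * K⁻¹` on the left and by `N` on the right; this clears
  -- the denominators of `K⁻¹ * B = M / N`
  have hmain : M * A * N = (q ^ 2)⁻¹ • (N * (↑K⁻¹ * (A * K)) * M) +
      (1 - (q ^ 2)⁻¹) • (a⁻¹ • (M * K * M) + a • (N * ↑K⁻¹ * N)) := by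
    have h3 := congrArg (fun X => N * ↑K⁻¹ * X * N) hB
    have e1 : N * (↑K⁻¹ : E) * (B * A) * N = M * A * N := by
      rw [← h2]; simp only [mul_assoc]
    have e2 : N * (↑K⁻¹ : E) * (A * B) * N = N * (↑K⁻¹ * (A * K)) * M := by
      simp only [mul_assoc, h1]
    have e3 : N * (↑K⁻¹ : E) * (B * B) * N = M * K * M := by
      rw [mul_assoc M, ← h1, ← h2]; simp only [mul_assoc]
    simp only [mul_add, add_mul, mul_smul_comm, smul_mul_assoc, e1, e2, e3, mul_one] at h3
    simpa only [smul_add] using h3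
  rw [hconj, hA, hM, hN] at hmain
  rw [← hR, ← sub_eq_zero]
  have hne : q⁻¹ * (a⁻¹ - a) ≠ 0 := by
    refine mul_ne_zero (inv_ne_zero hq) fun h => ha2 ?_
    field_simp at h
    linear_combination -h
  refine (smul_eq_zero.1 ?_).resolve_left hne
  rw [← sub_eq_zero] at hmain
  rw [← hmain]
  simp only [mul_sub, sub_mul, mul_add, add_mul, mul_smul_comm, smul_mul_assoc, mul_one, one_mul,
    mul_assoc, hψ1, hψ2, smul_sub, smul_add]
  match_scalars <;> field_simp <;> ring

/-- If `X = Y (1 - t c ψ) / (1 - c ψ)`, then `X = t Y + (1 - t) Y / (1 - c ψ)`, where the quotient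
is a finite geometric series because `ψ` is nilpotent. -/
theorem eq_smul_add_smul_mul_geom_sum {n : ℕ} (hψ : ψ ^ n = 0) {c t : 𝕂} {X Y : E}
    (h : X * (1 - c • ψ) = Y * (1 - (t * c) • ψ)) :
    X = t • Y + (1 - t) • (Y * ∑ i ∈ Finset.range n, c ^ i • ψ ^ i) := by
  have hS : (1 - c • ψ) * ∑ i ∈ Finset.range n, c ^ i • ψ ^ i = 1 := by
    have := mul_neg_geom_sum (c • ψ) n
    simpa only [smul_pow, hψ, smul_zero, sub_zero] using this
  have h1 : (1 : E) - (t * c) • ψ = t • (1 - c • ψ) + (1 - t) • 1 := by module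
  have h2 := congrArg (· * ∑ i ∈ Finset.range n, c ^ i • ψ ^ i) h
  simp only [mul_assoc, hS, h1, add_mul, smul_mul_assoc, mul_one, mul_add,
    mul_smul_comm] at h2
  exact h2

end Algebra
end TD

namespace TD

variable {𝕂 V : Type*} [Field 𝕂] [AddCommGroup V] [Module 𝕂 V] {d : ℕ}
  {A As : Module.End 𝕂 V} {θ θs : Fin (d + 1) → 𝕂}

/-! ### Vanishing of the quadratic defect and uniqueness of `ψ` -/

/-- If the quadratic defect vanishes on a subspace invariant under `K` and `B`, then it vanishes on
the `A`-invariant subspace generated by it. -/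
theorem exists_invariant_le_ker_quadraticDefect {q a : 𝕂} (hq : q ≠ 0) (ha : a ≠ 0)
    (ha2 : a ^ 2 ≠ 1) {K B : Module.End 𝕂 V}
    (hK : K * A = (q ^ 2)⁻¹ • (A * K) + (1 - (q ^ 2)⁻¹) • (a • (K * K) + a⁻¹ • 1))
    (hB : B * A = (q ^ 2)⁻¹ • (A * B) + (1 - (q ^ 2)⁻¹) • (a⁻¹ • (B * B) + a • 1))
    {S : Submodule 𝕂 V} (hSK : ∀ v ∈ S, K v ∈ S) (hSB : ∀ v ∈ S, B v ∈ S)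
    (hSQ : ∀ v ∈ S, quadraticDefect q a K B v = 0) :
    ∃ Z : Submodule 𝕂 V, S ≤ Z ∧ (∀ v ∈ Z, A v ∈ Z) ∧
      ∀ v ∈ Z, quadraticDefect q a K B v = 0 := by
  obtain ⟨L, M, ⟨z, w, hM⟩, hQ⟩ := quadraticDefect_mul hq ha ha2 hK hB
  let good : Submodule 𝕂 V → Prop := fun T =>
    (∀ v ∈ T, K v ∈ T) ∧ (∀ v ∈ T, B v ∈ T) ∧ ∀ v ∈ T, quadraticDefect q a K B v = 0
  have hstep : ∀ T, good T → good (T ⊔ T.map A) := by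
    rintro T ⟨h1, h2, h3⟩
    have hl : ∀ v ∈ T, v ∈ T ⊔ T.map A := fun v hv => Submodule.mem_sup_left hv
    have hr : ∀ v ∈ T, A v ∈ T ⊔ T.map A := fun v hv =>
      Submodule.mem_sup_right (Submodule.mem_map_of_mem hv)
    refine ⟨fun v hv => ?_, fun v hv => ?_, fun v hv => ?_⟩ <;>
      obtain ⟨x, hx, _, ⟨y, hy, rfl⟩, rfl⟩ := Submodule.mem_sup.1 hv <;> rw [map_add]
    · refine Submodule.add_mem _ (hl _ (h1 x hx)) ?_
      have := LinearMap.congr_fun hK y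
      simp only [Module.End.mul_apply, LinearMap.add_apply, LinearMap.smul_apply,
        Module.End.one_apply] at this
      rw [this]
      exact Submodule.add_mem _ (Submodule.smul_mem _ _ (hr _ (h1 y hy))) (Submodule.smul_mem _ _
        (hl _ (T.add_mem (T.smul_mem _ (h1 _ (h1 y hy))) (T.smul_mem _ hy))))
    · refine Submodule.add_mem _ (hl _ (h2 x hx)) ?_
      have := LinearMap.congr_fun hB y
      simp only [Module.End.mul_apply, LinearMap.add_apply, LinearMap.smul_apply,
        Module.End.one_apply] at this
      rw [this]
      exact Submodule.add_mem _ (Submodule.smul_mem _ _ (hr _ (h2 y hy))) (Submodule.smul_mem _ _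
        (hl _ (T.add_mem (T.smul_mem _ (h2 _ (h2 y hy))) (T.smul_mem _ hy))))
    · have h4 := LinearMap.congr_fun hQ y
      have h5 : M y ∈ T := by
        rw [hM]
        exact T.add_mem (T.smul_mem z (h1 y hy)) (T.smul_mem w (h2 y hy))
      simp only [Module.End.mul_apply, LinearMap.add_apply, LinearMap.smul_apply,
        h3 y hy, h3 _ h5, map_zero, smul_zero, add_zero] at h4
      rw [h3 x hx, h4, add_zero]
  -- `D j` is the sum of the spaces `A ^ l S` with `l ≤ j`
  let D : ℕ → Submodule 𝕂 V := fun j => (fun T => T ⊔ T.map A)^[j] S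
  have hD : ∀ j, D (j + 1) = D j ⊔ (D j).map A := fun j => Function.iterate_succ_apply' _ _ _
  have hgood : ∀ j, good (D j) := by
    intro j
    induction j with
    | zero => exact ⟨hSK, hSB, hSQ⟩
    | succ j ih =>
      rw [hD]
      exact hstep _ ih
  refine ⟨⨆ j, D j, le_iSup D 0, fun v hv => ?_, fun v hv => ?_⟩
  · suffices h : (⨆ j, D j) ≤ (⨆ j, D j).comap A from h hv
    refine iSup_le fun j u hu => (le_iSup D (j + 1)) ?_
    rw [hD]
    exact Submodule.mem_sup_right (Submodule.mem_map_of_mem hu)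
  · suffices h : (⨆ j, D j) ≤ LinearMap.ker (quadraticDefect q a K B) from h hv
    exact iSup_le fun j u hu => (hgood j).2.2 u hu

namespace IsTDSystem

theorem kerK_le_splitU {i : ℕ} : kerK A As θ θs i ≤ splitU A As θ θs i := by
  rw [kerK, splitU, eigenSum_eq_specSum, eigenSum_eq_specSum, eigenSum_eq_specSum]
  exact inf_le_inf_left _ (specSum_mono fun j _ hj => by simp only [Set.mem_Icc] at *; omega)

theorem actsByWeights_splitU_iff (h : IsTDSystem A As θ θs) {q : 𝕂} {K : Module.End 𝕂 V}
    (hK : ∀ i, ∀ v ∈ splitU A As θ θs i, K v = q ^ ((d : ℤ) - 2 * (i : ℤ)) • v)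
    (X : Module.End 𝕂 V) : ActsByWeights d q (splitU A As θ θs) X ↔ X = K := by
  refine ⟨fun hX => h.ext_splitU fun i hi v hv => by rw [hX i hi v hv, hK i v hv], ?_⟩
  rintro rfl i _ v hv
  exact hK i v hv

theorem actsByWeights_splitUDown_iff (X : Module.End 𝕂 V) (q : 𝕂) :
    ActsByWeights d q (splitUDown A As θ θs) X ↔
      ActsByWeights d q (splitU A As (θ ∘ Fin.rev) θs) X :=
  forall₂_congr fun i hi => by rw [splitU_rev hi]

/-- A map that commutes with the raising map and vanishes on every `K_i` is zero. -/
theorem eq_zero_of_commute_raising [FiniteDimensional 𝕂 V] (h : IsTDSystem A As θ θs) {q a : 𝕂}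
    (hθ : ∀ i : Fin (d + 1), θ i =
      a * q ^ ((d : ℤ) - 2 * ((i : ℕ) : ℤ)) + a⁻¹ * q ^ (2 * ((i : ℕ) : ℤ) - (d : ℤ)))
    {K : (Module.End 𝕂 V)ˣ}
    (hK : ∀ i, ∀ v ∈ splitU A As θ θs i,
      (K : Module.End 𝕂 V) v = q ^ ((d : ℤ) - 2 * (i : ℤ)) • v)
    (hK' : ∀ i, ∀ v ∈ splitU A As θ θs i,
      (↑K⁻¹ : Module.End 𝕂 V) v = q ^ (2 * (i : ℤ) - (d : ℤ)) • v)
    {X : Module.End 𝕂 V} (hX : X * raising A a K = raising A a K * X)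
    (hX0 : ∀ i, 2 * i ≤ d → ∀ v ∈ kerK A As θ θs i, X v = 0) : X = 0 := by
  refine LinearMap.ker_eq_top.1 (h.eq_top_of_kerK_le (fun i hi v hv => hX0 i hi v hv) ?_)
  intro i v hv hXv
  have hR : A v - θ i • v = raising A a K v := by
    simp only [raising, LinearMap.sub_apply, LinearMap.smul_apply, hK i v hv, hK' i v hv, hθ i]
    module
  rw [LinearMap.mem_ker] at hXv ⊢
  rw [hR, ← Module.End.mul_apply, hX, Module.End.mul_apply, hXv, map_zero]

/-- `K⁻¹ * B` is unipotent: `K` and `B` preserve the lower flag and agree on its quotients. -/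
theorem one_sub_inv_mul_pow_eq_zero (h : IsTDSystem A As θ θs) {w w' : ℕ → 𝕂}
    {K B : (Module.End 𝕂 V)ˣ}
    (hK : ∀ i, ∀ v ∈ splitU A As θ θs i, (K : Module.End 𝕂 V) v = w i • v)
    (hK' : ∀ i, ∀ v ∈ splitU A As θ θs i, (↑K⁻¹ : Module.End 𝕂 V) v = w' i • v)
    (hB : ∀ i, ∀ v ∈ splitU A As (θ ∘ Fin.rev) θs i, (B : Module.End 𝕂 V) v = w i • v) :
    (1 - ↑K⁻¹ * (B : Module.End 𝕂 V)) ^ (d + 1) = 0 := by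
  have hlow : ∀ n, ∀ v ∈ specSum As θs (Set.Iio (n + 1)),
      (1 - ↑K⁻¹ * (B : Module.End 𝕂 V)) v ∈ specSum As θs (Set.Iio n) := fun n v hv => by
    have h1 := Submodule.sub_mem _ ((h.acts_sub_mem_lower hK n).2 v hv)
      ((h.rev.acts_sub_mem_lower hB n).2 v hv)
    have h2 : (1 - ↑K⁻¹ * (B : Module.End 𝕂 V)) v = (↑K⁻¹ : Module.End 𝕂 V)
        ((K : Module.End 𝕂 V) v - w n • v - ((B : Module.End 𝕂 V) v - w n • v)) := by
      have h3 : (↑K⁻¹ : Module.End 𝕂 V) ((K : Module.End 𝕂 V) v) = v := by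
        rw [← Module.End.mul_apply, Units.inv_mul, Module.End.one_apply]
      rw [sub_sub_sub_cancel_right, map_sub, h3]
      rfl
    rw [h2]
    exact (h.acts_sub_mem_lower hK' n).1 _ h1
  have hpow : ∀ n, ∀ v ∈ specSum As θs (Set.Iio n),
      ((1 - ↑K⁻¹ * (B : Module.End 𝕂 V)) ^ n) v = 0 := by
    intro n
    induction n with
    | zero =>
      intro v hv
      rw [specSum_eq_bot (by simp), Submodule.mem_bot] at hv
      simp [hv]
    | succ n ih =>
      intro v hv
      rw [pow_succ, Module.End.mul_apply]
      exact ih _ (hlow n v hv)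
  refine LinearMap.ext fun v => hpow (d + 1) v ?_
  rw [specSum_eq_top h.ordering_dual fun j hj => by simp only [Set.mem_Iio]; omega]
  trivial

theorem quadraticDefect_eq_zero [FiniteDimensional 𝕂 V] (h : IsTDSystem A As θ θs) {q a : 𝕂}
    (hq : q ≠ 0) (ha : a ≠ 0) (ha2 : a ^ 2 ≠ 1) {w : ℕ → 𝕂} {K B : Module.End 𝕂 V}
    (hK : K * A = (q ^ 2)⁻¹ • (A * K) + (1 - (q ^ 2)⁻¹) • (a • (K * K) + a⁻¹ • 1))
    (hB : B * A = (q ^ 2)⁻¹ • (A * B) + (1 - (q ^ 2)⁻¹) • (a⁻¹ • (B * B) + a • 1))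
    (hKw : ∀ i, 2 * i ≤ d → ∀ v ∈ kerK A As θ θs i, K v = w i • v)
    (hBw : ∀ i, 2 * i ≤ d → ∀ v ∈ kerK A As θ θs i, B v = w i • v) :
    quadraticDefect q a K B = 0 := by
  let S : Submodule 𝕂 V := ⨆ i : ℕ, ⨆ _ : 2 * i ≤ d, kerK A As θ θs i
  have hle : ∀ i, 2 * i ≤ d → kerK A As θ θs i ≤ S := fun i hi =>
    le_iSup₂_of_le (f := fun (i : ℕ) (_ : 2 * i ≤ d) => kerK A As θ θs i) i hi le_rfl
  have hSK : S ≤ S.comap K := iSup₂_le fun i hi v hv => by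
    rw [Submodule.mem_comap, hKw i hi v hv]
    exact S.smul_mem _ (hle i hi hv)
  have hSB : S ≤ S.comap B := iSup₂_le fun i hi v hv => by
    rw [Submodule.mem_comap, hBw i hi v hv]
    exact S.smul_mem _ (hle i hi hv)
  have hSQ : S ≤ LinearMap.ker (quadraticDefect q a K B) := iSup₂_le fun i hi v hv => by
    have h1 := hKw i hi v hv
    have h2 := hBw i hi v hv
    simp only [quadraticDefect, LinearMap.mem_ker, LinearMap.sub_apply, LinearMap.smul_apply,
      Module.End.mul_apply, h1, h2, map_sub, map_smul, sub_self, smul_zero, map_zero]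
  obtain ⟨Z, hSZ, hAZ, hQZ⟩ := exists_invariant_le_ker_quadraticDefect hq ha ha2 hK hB
    (S := S) (fun v hv => hSK hv) (fun v hv => hSB hv) (fun v hv => hSQ hv)
  have hZ : Z = ⊤ := h.eq_top_of_kerK_le (fun i hi => (hle i hi).trans hSZ)
    fun i v _ hv => Z.sub_mem (hAZ v hv) (Z.smul_mem _ hv)
  exact LinearMap.ext fun v => hQZ v (by rw [hZ]; trivial)

end IsTDSystem

/-! ### The raising maps, and the equations for `ψ` -/

theorem raising_inv_eq {a : 𝕂} (ha : a ≠ 0) {K B : (Module.End 𝕂 V)ˣ} {ψ : Module.End 𝕂 V}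
    {n : ℕ} {c c' : 𝕂}
    (hB : (B : Module.End 𝕂 V) = a ^ 2 • (K : Module.End 𝕂 V) +
      (1 - a ^ 2) • ((K : Module.End 𝕂 V) * ∑ i ∈ Finset.range n, c ^ i • ψ ^ i))
    (hB' : (↑B⁻¹ : Module.End 𝕂 V) = a⁻¹ ^ 2 • (↑K⁻¹ : Module.End 𝕂 V) +
      (1 - a⁻¹ ^ 2) • ((↑K⁻¹ : Module.End 𝕂 V) * ∑ i ∈ Finset.range n, c' ^ i • ψ ^ i)) :
    raising A a⁻¹ B = raising A a K + (a - a⁻¹) • ∑ i ∈ Finset.range n,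
      (c ^ i • (K : Module.End 𝕂 V) - c' ^ i • (↑K⁻¹ : Module.End 𝕂 V)) * ψ ^ i := by
  have hsum : ∑ i ∈ Finset.range n,
      (c ^ i • (K : Module.End 𝕂 V) - c' ^ i • (↑K⁻¹ : Module.End 𝕂 V)) * ψ ^ i =
      (K : Module.End 𝕂 V) * (∑ i ∈ Finset.range n, c ^ i • ψ ^ i) -
        (↑K⁻¹ : Module.End 𝕂 V) * ∑ i ∈ Finset.range n, c' ^ i • ψ ^ i := by
    simp only [Finset.mul_sum, sub_mul, Finset.sum_sub_distrib, mul_smul_comm, smul_mul_assoc]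
  rw [hsum, raising, raising, hB, hB', inv_inv]
  match_scalars <;> field_simp
  all_goals ring

end TD

theorem lemma10p1 {𝕂 V : Type*} [Field 𝕂] [IsAlgClosed 𝕂] [AddCommGroup V] [Module 𝕂 V]
    [FiniteDimensional 𝕂 V] [Nontrivial V] (d : ℕ) (hd : 1 ≤ d)
    (A As : Module.End 𝕂 V) (θ θs : Fin (d + 1) → 𝕂) (hΦ : TD.IsTDSystem A As θ θs)
    (q a b : 𝕂) (hq : q ≠ 0) (ha : a ≠ 0) (hb : b ≠ 0) (hq4 : q ^ 4 ≠ 1)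
    (hθ : ∀ i : Fin (d + 1), θ i =
      a * q ^ ((d : ℤ) - 2 * ((i : ℕ) : ℤ)) + a⁻¹ * q ^ (2 * ((i : ℕ) : ℤ) - (d : ℤ)))
    (hθs : ∀ i : Fin (d + 1), θs i =
      b * q ^ ((d : ℤ) - 2 * ((i : ℕ) : ℤ)) + b⁻¹ * q ^ (2 * ((i : ℕ) : ℤ) - (d : ℤ))) :
    ∃ (K B : (Module.End 𝕂 V)ˣ) (ψ : Module.End 𝕂 V),
      -- `K`, `B` and `ψ` are the unique maps with their defining properties
      (∀ X : Module.End 𝕂 V, TD.ActsByWeights d q (TD.splitU A As θ θs) X ↔ X = K) ∧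
      (∀ X : Module.End 𝕂 V, TD.ActsByWeights d q (TD.splitUDown A As θ θs) X ↔ X = B) ∧
      (∀ X : Module.End 𝕂 V, TD.IsPsi A As θ θs q a K X ↔ X = ψ) ∧
      -- `B`, `B⁻¹`, `R ⇓` in terms of `ψ`, `K`, `K⁻¹`, `R`
      (B : Module.End 𝕂 V) = a ^ 2 • (K : Module.End 𝕂 V) +
        (1 - a ^ 2) • ((K : Module.End 𝕂 V) *
          ∑ i ∈ Finset.range (d + 1), (a⁻¹ ^ i * q⁻¹ ^ i) • ψ ^ i) ∧
      (↑B⁻¹ : Module.End 𝕂 V) = a⁻¹ ^ 2 • (↑K⁻¹ : Module.End 𝕂 V) +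
        (1 - a⁻¹ ^ 2) • ((↑K⁻¹ : Module.End 𝕂 V) *
          ∑ i ∈ Finset.range (d + 1), (a ^ i * q ^ i) • ψ ^ i) ∧
      TD.raising A a⁻¹ B = TD.raising A a K + (a - a⁻¹) •
        ∑ i ∈ Finset.range (d + 1),
          ((a⁻¹ ^ i * q⁻¹ ^ i) • (K : Module.End 𝕂 V) -
            (a ^ i * q ^ i) • (↑K⁻¹ : Module.End 𝕂 V)) * ψ ^ i ∧
      -- `K`, `K⁻¹`, `R` in terms of `ψ`, `B`, `B⁻¹`, `R ⇓`
      (K : Module.End 𝕂 V) = a⁻¹ ^ 2 • (B : Module.End 𝕂 V) +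
        (1 - a⁻¹ ^ 2) • ((B : Module.End 𝕂 V) *
          ∑ i ∈ Finset.range (d + 1), (a ^ i * q⁻¹ ^ i) • ψ ^ i) ∧
      (↑K⁻¹ : Module.End 𝕂 V) = a ^ 2 • (↑B⁻¹ : Module.End 𝕂 V) +
        (1 - a ^ 2) • ((↑B⁻¹ : Module.End 𝕂 V) *
          ∑ i ∈ Finset.range (d + 1), (a⁻¹ ^ i * q ^ i) • ψ ^ i) ∧
      TD.raising A a K = TD.raising A a⁻¹ B + (a - a⁻¹) •
        ∑ i ∈ Finset.range (d + 1),
          ((a⁻¹ ^ i * q ^ i) • (↑B⁻¹ : Module.End 𝕂 V) -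
            (a ^ i * q⁻¹ ^ i) • (B : Module.End 𝕂 V)) * ψ ^ i := by
  -- otherwise `θ 0 = θ d`
  have ha2 : a ^ 2 ≠ 1 := by
    intro h
    have hinv : a⁻¹ = a := inv_eq_of_mul_eq_one_left (by rw [← sq, h])
    have h0 : θ 0 = θ (Fin.last d) := by
      rw [hθ, hθ, hinv, Fin.val_zero, Fin.val_last, add_comm]
      congr 3 <;> push_cast <;> ring
    have := congrArg Fin.val (hΦ.ordering.injective h0)
    simp only [Fin.val_zero, Fin.val_last] at this
    omega
  -- the reversed ordering has the same form, with `a⁻¹` in place of `a`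
  have hθr : ∀ i : Fin (d + 1), (θ ∘ Fin.rev) i =
      a⁻¹ * q ^ ((d : ℤ) - 2 * ((i : ℕ) : ℤ)) + a⁻¹⁻¹ * q ^ (2 * ((i : ℕ) : ℤ) - (d : ℤ)) := by
    intro i
    have hi : ((Fin.rev i : ℕ) : ℤ) = (d : ℤ) - ((i : ℕ) : ℤ) := by rw [Fin.val_rev]; omega
    rw [Function.comp_apply, hθ, hi, inv_inv, add_comm]
    congr 3 <;> ring
  obtain ⟨K, hK, hK', hKA⟩ := hΦ.exists_weight_unit hq ha hθ
  obtain ⟨B, hB, hB', hBA⟩ := hΦ.rev.exists_weight_unit hq (inv_ne_zero ha) hθr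
  rw [inv_inv] at hBA
  have hKk : ∀ i, 2 * i ≤ d → ∀ v ∈ TD.kerK A As θ θs i,
      (K : Module.End 𝕂 V) v = q ^ ((d : ℤ) - 2 * (i : ℤ)) • v := fun i hi v hv =>
    hK i v (TD.IsTDSystem.kerK_le_splitU hv)
  have hBk : ∀ i, 2 * i ≤ d → ∀ v ∈ TD.kerK A As θ θs i,
      (B : Module.End 𝕂 V) v = q ^ ((d : ℤ) - 2 * (i : ℤ)) • v := fun i hi v hv =>
    hB i v (TD.IsTDSystem.kerK_le_splitU (by rwa [TD.kerK_rev hi]))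
  have hQ := hΦ.quadraticDefect_eq_zero hq ha ha2 hKA hBA hKk hBk
  obtain ⟨u, ψ, hu, h1, h2, hψ0⟩ := TD.exists_moebius (q := q) ha ha2
    (hΦ.one_sub_inv_mul_pow_eq_zero hK hK' hB)
  have hψK := TD.mul_eq_of_quadraticDefect_eq_zero hu h1 h2 hQ
  have hBK := TD.mul_one_sub_eq hq ha hu h1
  have hBK' := TD.inv_mul_one_sub_eq hq hψK hBK
  have hcomm := TD.commutator_eq hq ha ha2 hKA hBA hψK hBK (TD.one_sub_mul_eq hu hq ha h2)
  have hψk : ∀ i, 2 * i ≤ d → ∀ v ∈ TD.kerK A As θ θs i, ψ v = 0 := by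
    intro i hi v hv
    have h3 : (1 - ↑K⁻¹ * (B : Module.End 𝕂 V)) v = 0 := by
      rw [LinearMap.sub_apply, Module.End.mul_apply, hBk i hi v hv, ← hKk i hi v hv,
        ← Module.End.mul_apply, Units.inv_mul, sub_self]
    have h4 : (↑u⁻¹ : Module.End 𝕂 V) (((u : Module.End 𝕂 V) * ψ) v) = 0 := by
      rw [h1, LinearMap.smul_apply, h3, smul_zero, map_zero]
    rwa [← Module.End.mul_apply, Units.inv_mul_cancel_left] at h4
  have hpsi : TD.IsPsi A As θ θs q a K ψ := ⟨hcomm, hψk⟩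
  have e1 := TD.eq_smul_add_smul_mul_geom_sum hψ0 (c := a⁻¹ * q⁻¹) (t := a ^ 2)
    (by rw [hBK]; congr 3; field_simp)
  have e2 := TD.eq_smul_add_smul_mul_geom_sum hψ0 (c := a * q) (t := a⁻¹ ^ 2)
    (by rw [hBK']; congr 3; field_simp)
  have e4 := TD.eq_smul_add_smul_mul_geom_sum hψ0 (c := a * q⁻¹) (t := a⁻¹ ^ 2)
    (by rw [← hBK]; congr 3; field_simp)
  have e5 := TD.eq_smul_add_smul_mul_geom_sum hψ0 (c := a⁻¹ * q) (t := a ^ 2)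
    (by rw [← hBK']; congr 3; field_simp)
  have e3 := TD.raising_inv_eq (A := A) ha e1 e2
  -- `K` and `B` exchange their roles, and `a` becomes `a⁻¹`
  have e6 := TD.raising_inv_eq (A := A) (a := a⁻¹) (inv_ne_zero ha) e4 (by rw [inv_inv]; exact e5)
  refine ⟨K, B, ψ, hΦ.actsByWeights_splitU_iff hK, fun X =>
    (TD.IsTDSystem.actsByWeights_splitUDown_iff X q).trans
      (hΦ.rev.actsByWeights_splitU_iff hB X), fun X => ⟨fun hX => ?_, ?_⟩, ?_⟩
  · refine sub_eq_zero.1 (hΦ.eq_zero_of_commute_raising hθ hK hK' ?_ fun i hi v hv => ?_)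
    · rw [sub_mul, mul_sub, ← sub_eq_zero]
      rw [← sub_eq_zero.2 (hX.commutator.trans hpsi.commutator.symm)]
      abel
    · rw [LinearMap.sub_apply, hX.vanish i hi v hv, hψk i hi v hv, sub_zero]
  · rintro rfl
    exact hpsi
  · simp only [← mul_pow]
    refine ⟨e1, e2, e3, e4, e5, ?_⟩
    rw [inv_inv] at e6
    rw [e6, ← neg_sub a a⁻¹, neg_smul, ← smul_neg, ← Finset.sum_neg_distrib]
    simp only [← neg_mul, neg_sub]
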